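/- Let $a,b,a_1,b_1:[0,\infty)\to\mathbb R$ be Lebesgue measurable and essentially bounded, and let $g,h:[0,\infty)\to\mathbb R$ be Lebesgue measurable with $g(t)\le t$, $h(t)\le t$ for $t\ge 0$. Consider $$\ddot x(t)+a(t)\dot x(t)+b(t)x(t)+a_1(t)\dot x(g(t))+b_1(t)x(h(t))=0 .\qquad (2)$$ For $t_0\ge 0$, $x_0,x_0'\in\mathbb R$ and bounded Borel functions $\varphi,\psi:(-\infty,t_0)\to\mathbb R$, the solution with these data is the function $x$ with $x=\varphi$, $\dot x=\psi$ on $(-\infty,t_0)$ (here $\psi$ is prescribed independently of $\varphi$), $x(t_0)=x_0$, $\dot x(t_0)=x_0'$, whose derivative $\dot x$ is locally absolutely continuous on $[t_0,\infty)$ and which satisfies the equation for almost every $t\ge t_0$. Equation (2) is called exponentially stable if there are $M,\mu>0$, independent of $t_0$ and of the data, such that $$|x(t)|\le M e^{-\mu(t-t_0)}\Big[|x_0|+|x_0'|+\sup_{s<t_0}\big(|\varphi(s)|+|\psi(s)|\big)\Big],\qquad t\ge t_0,$$ for all $t_0\ge 0$ and all such data; the same definition is used for the ordinary differential equation $$\ddot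 x(t)+a(t)\dot x(t)+b(t)x(t)=0 ,\qquad (11)$$ which is (2) with $a_1=b_1=0$. Let $Y(t,s)$ be the fundamental function of (11), i.e. for each $s\ge 0$ the solution of (11) with $x=\dot x=0$ on $(-\infty,s)$, $x(s)=0$, $\dot x(s)=1$. **Theorem 4.** Suppose that (11) is exponentially stable, that $a(t)\ge\alpha$ for almost every $t\ge 0$ with a constant $\alpha>0$, and that $t-g(t)\le\delta$, $t-h(t)\le\tau$ for all $t\ge 0$ with constants $\delta,\tau$. Suppose that for some $t_0\ge 0$, with $\|\cdot\|$ the norm of $L_\infty[t_0,\infty)$ and $$Y=\sup_{t>t_0}\int_{t_0}^t|Y(t,s)|\,ds ,$$ we have $\left\|\frac{a_1}{a}\right\|<1$ and $$Y\left[\frac{\|a_1\|\left(\left\|\frac ba\right\|+\left\|\frac{b_1}a\right\|\right)}{1-\left\|\frac{a_1}a\right\|}+\|b_1\|\right]<1 .$$ Then equation (2) is exponentially stable. -/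

import Mathlib

open Set MeasureTheory

/-- The pair `(x, y)`, with `y` in the role of `x'`, solves on `[t₀, ∞)` the equation
`x''(t) + a(t) x'(t) + b(t) x(t) + a₁(t) x'(g(t)) + b₁(t) x(h(t)) = 0`
with prescribed history `x = φ`, `x' = ψ` on `(-∞, t₀)` and initial values
`x(t₀) = x₀`, `x'(t₀) = x₀'`. The history `ψ` need not be the derivative of `φ`. -/
structure IsSolution (a b a₁ b₁ g h : ℝ → ℝ) (t₀ x₀ x₀' : ℝ) (φ ψ x y : ℝ → ℝ) : Prop where
  history : ∀ t < t₀, x t = φ t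
  history' : ∀ t < t₀, y t = ψ t
  init : x t₀ = x₀
  init' : y t₀ = x₀'
  /-- `y` is the derivative of `x` on `[t₀, ∞)` (one-sided at `t₀`). -/
  hasDeriv : ∀ t ≥ t₀, HasDerivWithinAt x (y t) (Ici t₀) t
  /-- `y = x'` is locally absolutely continuous on `[t₀, ∞)`. -/
  absCont : ∀ T ≥ t₀, AbsolutelyContinuousOnInterval y t₀ T
  /-- The equation holds almost everywhere on `[t₀, ∞)`. -/
  equation : ∀ᵐ t ∂(volume.restrict (Ici t₀)),
    ∃ x'' : ℝ, HasDerivAt y x'' t ∧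
      x'' + a t * y t + b t * x t + a₁ t * y (g t) + b₁ t * x (h t) = 0

/-- Uniform exponential stability of
`x''(t) + a(t) x'(t) + b(t) x(t) + a₁(t) x'(g(t)) + b₁(t) x(h(t)) = 0`:
`M` and `μ` serve all initial times `t₀ ≥ 0`, all initial values and all bounded Borel
histories `φ`, `ψ` on `(-∞, t₀)`. -/
def ExpStable (a b a₁ b₁ g h : ℝ → ℝ) : Prop :=
  ∃ M > 0, ∃ μ > 0, ∀ t₀ ≥ (0 : ℝ), ∀ (x₀ x₀' : ℝ) (φ ψ : ℝ → ℝ),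
    Measurable φ → Measurable ψ →
    (∃ C, ∀ t < t₀, |φ t| ≤ C) → (∃ C, ∀ t < t₀, |ψ t| ≤ C) →
    ∀ x y : ℝ → ℝ, IsSolution a b a₁ b₁ g h t₀ x₀ x₀' φ ψ x y →
      ∀ t ≥ t₀, |x t| ≤ M * Real.exp (-μ * (t - t₀)) *
        (|x₀| + |x₀'| + ⨆ s : Iio t₀, (|φ s| + |ψ s|))

/-- Exponential stability of the ordinary equation `x''(t) + a(t) x'(t) + b(t) x(t) = 0`. -/
def ODEExpStable (a b : ℝ → ℝ) : Prop :=
  ExpStable a b 0 0 id id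

open Classical in
/-- The fundamental function `Y(t, s)` of `x''(t) + a(t) x'(t) + b(t) x(t) = 0`: for fixed `s`,
the solution with `x = x' = 0` on `(-∞, s)`, `x(s) = 0` and `x'(s) = 1`. For essentially bounded
measurable coefficients on `[0, ∞)` and `s ≥ 0` this solution exists and is unique. -/
noncomputable def odeFundamental (a b : ℝ → ℝ) (t s : ℝ) : ℝ :=
  if H : ∃ x : ℝ → ℝ, ∃ y : ℝ → ℝ, IsSolution a b 0 0 id id s 0 1 0 0 x y then H.choose t else 0

/-- `sup_{t > t₀} ∫_{t₀}^t |Y(t, s)| ds`, as an extended nonnegative number. -/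
noncomputable def fundamentalBound (a b : ℝ → ℝ) (t₀ : ℝ) : ENNReal :=
  ⨆ t > t₀, ∫⁻ s in Ioc t₀ t, ‖odeFundamental a b t s‖ₑ

/-- The norm of `L_∞[t₀, ∞)`, as an extended nonnegative number. -/
noncomputable def normInf (t₀ : ℝ) (f : ℝ → ℝ) : ENNReal :=
  eLpNorm f ⊤ (volume.restrict (Ici t₀))

/-! Fix a small weight `μ > 0` and let `P`, `Q` be the maxima over `[t₁, T]` of `|x|` and `|x'|`
multiplied by `e^{μ(t - t₁)}`. Two estimates couple them, written here at `μ = 0` and up to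
multiples of the data.

Read as a first-order equation for `x'`, the equation has the forcing `-(b x + a₁ x'(g) + b₁ x(h))`.
A forcing of size at most `a G` produces a response of size at most `G`, because the integrating
factor `E = exp ∫ a` satisfies `E' = a E`. Hence `Q ≤ ‖b/a‖ P + ‖a₁/a‖ Q + ‖b₁/a‖ P`
(`first_order_decay`), which can be solved for `Q` since `‖a₁/a‖ < 1`. Read as (11) forced by the
delayed terms, the equation gives `P ≤ Y (‖a₁‖ Q + ‖b₁‖ P)` by variation of constants
(`exists_cauchy_function`). Eliminating `Q` bounds `P` by the data plus `P` times the quantity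
assumed to be less than 1 (`coupled_bound`).

A positive `μ` perturbs the gains to `α / (α - μ)`, `e^{μD}` for delays at most `D`, and `Y + M
(1/(ν - μ) - 1/ν)` (`integral_weighted_odeFundamental_le`). All are continuous at `μ = 0`, so the
strict inequalities persist (`exists_small_weight`). The bounds do not depend on `T`, which is the
decay. If the initial time precedes `t₀`, a Gronwall bound (`IsSolution.growth`) carries the
solution to `t₀`, where it is restarted. -/

/-- Comparison principle: if `|f'| ≤ V'` almost everywhere on `[s, t]` and both functions are
absolutely continuous, the increments compare. -/
theorem AbsolutelyContinuousOnInterval.abs_sub_le {f V : ℝ → ℝ} {s t : ℝ} (hst : s ≤ t)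
    (hf : AbsolutelyContinuousOnInterval f s t) (hV : AbsolutelyContinuousOnInterval V s t)
    (h : ∀ᵐ r, r ∈ Icc s t → ∃ f' V' : ℝ, HasDerivAt f f' r ∧ HasDerivAt V V' r ∧ |f'| ≤ V') :
    |f t - f s| ≤ V t - V s := by
  rw [← hf.integral_deriv_eq_sub, ← hV.integral_deriv_eq_sub, ← Real.norm_eq_abs]
  refine intervalIntegral.norm_integral_le_of_norm_le hst ?_ hV.intervalIntegrable_deriv
  filter_upwards [h] with r hr hrm
  obtain ⟨f', V', h1, h2, h3⟩ := hr (Ioc_subset_Icc_self hrm)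
  rwa [h1.deriv, h2.deriv]

/-- A function with an everywhere defined, continuous derivative on `[s, t]` is absolutely
continuous there. -/
theorem AbsolutelyContinuousOnInterval.of_hasDerivWithinAt {x y : ℝ → ℝ} {s t : ℝ} (hst : s ≤ t)
    (hx : ∀ r ∈ Icc s t, HasDerivWithinAt x (y r) (Icc s t) r) (hy : ContinuousOn y (Icc s t)) :
    AbsolutelyContinuousOnInterval x s t := by
  obtain ⟨C, hC⟩ := isCompact_Icc.exists_bound_of_continuousOn hy
  have : LipschitzOnWith (Real.toNNReal C) x (Icc s t) :=
    (convex_Icc s t).lipschitzOnWith_of_nnnorm_hasDerivWithin_le hx fun r hr => by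
      rw [← NNReal.coe_le_coe, coe_nnnorm]
      exact (hC r hr).trans (Real.le_coe_toNNReal C)
  rw [← uIcc_of_le hst] at this
  exact this.absolutelyContinuousOnInterval

theorem ae_abs_le_toReal_eLpNorm {f : ℝ → ℝ} {μ : Measure ℝ} (hf : eLpNorm f ⊤ μ ≠ ⊤) :
    ∀ᵐ t ∂μ, |f t| ≤ (eLpNorm f ⊤ μ).toReal := by
  have h1 := ae_le_eLpNormEssSup (f := f) (μ := μ)
  rw [eLpNorm_exponent_top] at hf ⊢
  filter_upwards [h1] with t ht
  simpa using ENNReal.toReal_mono hf ht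

/-- An a.e. bounded function has an everywhere bounded measurable representative. -/
theorem exists_bounded_measurable_rep {f : ℝ → ℝ} {S : Set ℝ}
    (hf : MemLp f ⊤ (volume.restrict S)) :
    ∃ K ≥ (0 : ℝ), ∃ F : ℝ → ℝ, Measurable F ∧ (∀ t, |F t| ≤ K) ∧
      ∀ᵐ t ∂(volume.restrict S), f t = F t := by
  have hb := ae_abs_le_toReal_eLpNorm hf.2.ne
  set K := (eLpNorm f ⊤ (volume.restrict S)).toReal
  have hK : 0 ≤ K := ENNReal.toReal_nonneg
  refine ⟨K, hK, fun t => max (-K) (min K (hf.1.mk f t)), ?_, ?_, ?_⟩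
  · have := hf.1.stronglyMeasurable_mk.measurable
    fun_prop
  · intro t
    rw [abs_le]
    exact ⟨le_max_left _ _, max_le (by linarith) (min_le_left _ _)⟩
  · filter_upwards [hb, hf.1.ae_eq_mk] with t h1 h2
    rw [← h2]
    rw [abs_le] at h1
    rw [min_eq_right h1.2, max_eq_right h1.1]

theorem MeasureTheory.LocallyIntegrable.intervalIntegrable_of_real {E : Type*}
    [NormedAddCommGroup E] {f : ℝ → E} (hf : LocallyIntegrable f) (s t : ℝ) :
    IntervalIntegrable f volume s t :=
  intervalIntegrable_iff.mpr
    ((hf.integrableOn_isCompact isCompact_uIcc).mono_set uIoc_subset_uIcc)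

/-! ### Linear Carathéodory equations: existence -/

open BoundedContinuousFunction in
/-- Global existence for the linear equation `z' = L(t) z`, `z(0) = c`, with a bounded measurable
coefficient, in integral form. -/
theorem exists_linear_integral_solution {E : Type*} [NormedAddCommGroup E] [NormedSpace ℝ E]
    [CompleteSpace E] {L : ℝ → E →L[ℝ] E} (hL : StronglyMeasurable L) {K : ℝ}
    (hK : ∀ t, ‖L t‖ ≤ K) (c : E) :
    ∃ z : ℝ → E, Continuous z ∧ LocallyIntegrable (fun s => L s (z s)) ∧
      ∀ t ≥ 0, z t = c + ∫ s in (0 : ℝ)..t, L s (z s) := by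
  have hK0 : 0 ≤ K := (norm_nonneg _).trans (hK 0)
  -- Bielecki weight: after multiplication by `e^{-lt}` the Picard operator has Lipschitz constant
  -- at most `K / l ≤ 1/2`. The `+ 1` keeps `l` positive when `K = 0`.
  set l : ℝ := 2 * (K + 1) with hl
  have hlpos : 0 < l := by positivity
  have hmeas : ∀ z : ℝ → E, Continuous z → StronglyMeasurable fun s => L s (z s) := fun z hz =>
    isBoundedBilinearMap_apply.continuous.comp_stronglyMeasurable (hL.prodMk hz.stronglyMeasurable)
  have hloc : ∀ z : ℝ → E, Continuous z → LocallyIntegrable (fun s => L s (z s)) := by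
    intro z hz
    have hzn : LocallyIntegrable (fun s => K * ‖z s‖) :=
      Continuous.locallyIntegrable (by fun_prop)
    refine hzn.mono (hmeas z hz).aestronglyMeasurable (Filter.Eventually.of_forall fun s => ?_)
    rw [Real.norm_eq_abs (K * _), abs_of_nonneg (by positivity)]
    exact (L s).le_of_opNorm_le (hK s) _
  have hint : ∀ z : ℝ → E, Continuous z → ∀ t,
      IntervalIntegrable (fun s => Real.exp (l * s) • L s (z s)) volume 0 t := by
    intro z hz t
    exact ((hloc z hz).intervalIntegrable_of_real 0 t).continuousOn_smul (by fun_prop)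
  have hexp : ∀ t ≥ 0, ∫ s in (0 : ℝ)..t, Real.exp (l * s) = (Real.exp (l * t) - 1) / l := by
    intro t _
    rw [intervalIntegral.integral_comp_mul_left (fun s => Real.exp s) hlpos.ne']
    simp [integral_exp]
    ring
  have hbd : ∀ (w : ℝ → E) (B : ℝ), 0 ≤ B → (∀ s, ‖w s‖ ≤ B) → ∀ t ≥ 0,
      ‖Real.exp (-(l * t)) • ∫ s in (0 : ℝ)..t, Real.exp (l * s) • L s (w s)‖ ≤ B / 2 := by
    intro w B hB hw t ht
    have h1 : ‖∫ s in (0 : ℝ)..t, Real.exp (l * s) • L s (w s)‖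
        ≤ ∫ s in (0 : ℝ)..t, Real.exp (l * s) * (K * B) := by
      refine intervalIntegral.norm_integral_le_of_norm_le ht ?_
        (Continuous.intervalIntegrable (by fun_prop) _ _)
      refine Filter.Eventually.of_forall fun s _ => ?_
      rw [norm_smul, Real.norm_eq_abs, Real.abs_exp]
      gcongr
      exact ((L s).le_of_opNorm_le (hK s) _).trans (by gcongr; exact hw s)
    rw [norm_smul, Real.norm_eq_abs, Real.abs_exp]
    rw [intervalIntegral.integral_mul_const, hexp t ht] at h1
    calc _ ≤ Real.exp (-(l * t)) * ((Real.exp (l * t) - 1) / l * (K * B)) := by gcongr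
      _ = (1 - Real.exp (-(l * t))) * (K * B) / l := by
        have : Real.exp (-(l * t)) * Real.exp (l * t) = 1 := by rw [← Real.exp_add]; simp
        linear_combination (K * B) / l * this
      _ ≤ 1 * (K * B) / l := by
        gcongr
        linarith [Real.exp_pos (-(l * t))]
      _ ≤ B / 2 := by
        rw [div_le_div_iff₀ hlpos two_pos, hl]
        nlinarith
  -- Picard operator for the weighted unknown `e^{-lt} z(t)`. The cutoff `max t 0` freezes it on the
  -- negative axis, so that it acts on bounded continuous functions on all of `ℝ`.
  let G : (ℝ → E) → ℝ → E := fun z t => Real.exp (-(l * max t 0)) •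
    (c + ∫ s in (0 : ℝ)..(max t 0), Real.exp (l * s) • L s (z s))
  have hGc : ∀ z : ℝ → E, Continuous z → Continuous (G z) := by
    intro z hz
    have h1 : Continuous fun t => ∫ s in (0 : ℝ)..t, Real.exp (l * s) • L s (z s) :=
      intervalIntegral.continuous_primitive (fun a b => ((hint z hz a).symm.trans (hint z hz b))) 0
    have h2 : Continuous fun t : ℝ => max t 0 := by fun_prop
    exact Continuous.smul (by fun_prop) (continuous_const.add (h1.comp h2))
  have hGb : ∀ z : ℝ →ᵇ E, ∀ t, ‖G z t‖ ≤ ‖c‖ + ‖z‖ / 2 := by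
    intro z t
    have := hbd z ‖z‖ (norm_nonneg _) z.norm_coe_le_norm (max t 0) (le_max_right _ _)
    simp only [G, smul_add]
    refine (norm_add_le _ _).trans (add_le_add ?_ this)
    rw [norm_smul, Real.norm_eq_abs, Real.abs_exp]
    refine mul_le_of_le_one_left (norm_nonneg _) (Real.exp_le_one_iff.2 ?_)
    have : 0 ≤ max t 0 := le_max_right _ _
    nlinarith
  let T : (ℝ →ᵇ E) → (ℝ →ᵇ E) := fun z =>
    BoundedContinuousFunction.ofNormedAddCommGroup (G z) (hGc z z.continuous) _ (hGb z)
  have hT : ContractingWith (1 / 2) T := by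
    refine ⟨by norm_num, LipschitzWith.of_dist_le_mul fun z w => ?_⟩
    rw [BoundedContinuousFunction.dist_le (by positivity)]
    intro t
    have h1 : T z t - T w t = Real.exp (-(l * max t 0)) •
        ∫ s in (0 : ℝ)..(max t 0), Real.exp (l * s) • L s ((z - w) s) := by
      simp only [T, G, BoundedContinuousFunction.coe_ofNormedAddCommGroup, ← smul_sub,
        add_sub_add_left_eq_sub]
      rw [← intervalIntegral.integral_sub (hint z z.continuous _) (hint w w.continuous _)]
      simp [smul_sub]
    rw [dist_eq_norm, h1, dist_eq_norm]
    refine (hbd _ ‖z - w‖ (norm_nonneg _) (z - w).norm_coe_le_norm _ (le_max_right _ _)).trans ?_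
    simp
    linarith
  set z := ContractingWith.fixedPoint T hT
  have hz : T z = z := hT.fixedPoint_isFixedPt
  refine ⟨fun t => Real.exp (l * t) • z t, by fun_prop,
    hloc _ (by fun_prop), fun t ht => ?_⟩
  have h1 : z t = G z t := by
    conv_lhs => rw [← hz]
    rfl
  simp only [G, max_eq_left ht] at h1
  beta_reduce
  rw [h1, smul_smul, ← Real.exp_add]
  simp

/-- Post-composition with a locally Lipschitz function preserves absolute continuity. -/
theorem AbsolutelyContinuousOnInterval.lipschitz_comp {f φ : ℝ → ℝ} {a b : ℝ} {K : NNReal}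
    (hφ : LipschitzOnWith K φ (f '' uIcc a b)) (hf : AbsolutelyContinuousOnInterval f a b) :
    AbsolutelyContinuousOnInterval (fun t => φ (f t)) a b := by
  unfold AbsolutelyContinuousOnInterval at hf ⊢
  refine squeeze_zero' ?_ ?_ (by simpa using Filter.Tendsto.const_mul (K : ℝ) hf)
  · exact Filter.Eventually.of_forall <| fun _ ↦ Finset.sum_nonneg (fun i hi ↦ dist_nonneg)
  rw [Filter.eventually_inf_principal]
  filter_upwards with E hE
  rw [Finset.mul_sum]
  refine Finset.sum_le_sum fun i hi => ?_
  exact hφ.dist_le_mul _ (mem_image_of_mem f (hE.1 i hi).1) _ (mem_image_of_mem f (hE.1 i hi).2)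

theorem AbsolutelyContinuousOnInterval.exp {f : ℝ → ℝ} {a b : ℝ}
    (hf : AbsolutelyContinuousOnInterval f a b) :
    AbsolutelyContinuousOnInterval (fun t => Real.exp (f t)) a b := by
  obtain ⟨C, hC⟩ := hf.exists_bound
  have hc : ContDiffOn ℝ 1 Real.exp (Icc (-C) C) := Real.contDiff_exp.contDiffOn
  obtain ⟨K, hK⟩ := hc.exists_lipschitzOnWith (by decide) (convex_Icc _ _) isCompact_Icc
  refine lipschitz_comp (hK.mono ?_) hf
  rintro _ ⟨t, ht, rfl⟩
  exact abs_le.1 (hC t ht)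

/-! ### The homogeneous ordinary equation and its Cauchy function -/

/-- `(u, v)` solves `u' = v`, `v' = -a v - b u` on `[0, ∞)` in the Carathéodory sense. -/
structure IsHomSol (a b u v : ℝ → ℝ) : Prop where
  deriv : ∀ t ≥ 0, HasDerivWithinAt u (v t) (Ici 0) t
  ac : ∀ T ≥ 0, AbsolutelyContinuousOnInterval v 0 T
  eq : ∀ᵐ t ∂(volume.restrict (Ici 0)), HasDerivAt v (-(a t * v t) - b t * u t) t

/-- Replacing the coefficients by bounded measurable representatives changes the equation only on a
null set, and the resulting planar linear system has a bounded coefficient matrix. -/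
theorem exists_isHomSol {a b : ℝ → ℝ} (ha : MemLp a ⊤ (volume.restrict (Ici 0)))
    (hb : MemLp b ⊤ (volume.restrict (Ici 0))) (p q : ℝ) :
    ∃ u v : ℝ → ℝ, IsHomSol a b u v ∧ u 0 = p ∧ v 0 = q := by
  obtain ⟨K, hK, A, hAm, hAK, hA⟩ := exists_bounded_measurable_rep ha
  obtain ⟨K', hK', B, hBm, hBK, hB⟩ := exists_bounded_measurable_rep hb
  let fs := ContinuousLinearMap.fst ℝ ℝ ℝ
  let sn := ContinuousLinearMap.snd ℝ ℝ ℝ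
  let L1 : (ℝ × ℝ) →L[ℝ] (ℝ × ℝ) := sn.prod 0
  let L2 : (ℝ × ℝ) →L[ℝ] (ℝ × ℝ) := (0 : (ℝ × ℝ) →L[ℝ] ℝ).prod (-sn)
  let L3 : (ℝ × ℝ) →L[ℝ] (ℝ × ℝ) := (0 : (ℝ × ℝ) →L[ℝ] ℝ).prod (-fs)
  let L : ℝ → (ℝ × ℝ) →L[ℝ] (ℝ × ℝ) := fun s => L1 + A s • L2 + B s • L3
  have hL : StronglyMeasurable L :=
    (stronglyMeasurable_const.add (hAm.stronglyMeasurable.smul_const L2)).add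
      (hBm.stronglyMeasurable.smul_const L3)
  have hLK : ∀ s, ‖L s‖ ≤ ‖L1‖ + K * ‖L2‖ + K' * ‖L3‖ := by
    intro s
    refine (norm_add₃_le).trans ?_
    rw [norm_smul, norm_smul]
    gcongr
    · exact hAK s
    · exact hBK s
  obtain ⟨z, hzc, hzi, hz⟩ := exists_linear_integral_solution hL hLK (p, q)
  have hv : ∀ t ≥ 0, (z t).2 = q + ∫ s in (0 : ℝ)..t, (L s (z s)).2 := by
    intro t ht
    conv_lhs => rw [hz t ht]
    exact congrArg (q + ·)
      (sn.intervalIntegral_comp_comm (hzi.intervalIntegrable_of_real 0 t)).symm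
  have hu : ∀ t ≥ 0, (z t).1 = p + ∫ s in (0 : ℝ)..t, (z s).2 := by
    intro t ht
    conv_lhs => rw [hz t ht]
    have := (fs.intervalIntegral_comp_comm (hzi.intervalIntegrable_of_real 0 t)).symm
    simpa [fs, L, L1, L2, L3, sn] using this
  have hzi2 : LocallyIntegrable (fun s => (L s (z s)).2) := by
    refine hzi.mono (continuous_snd.comp_aestronglyMeasurable hzi.aestronglyMeasurable) ?_
    exact Filter.Eventually.of_forall fun s => norm_snd_le _
  -- The velocity is taken as the integral itself, so that absolute continuity and the a.e.
  -- derivative are immediate; it agrees with `(z t).2` for `t ≥ 0`.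
  refine ⟨fun t => (z t).1, fun t => q + ∫ s in (0 : ℝ)..t, (L s (z s)).2, ⟨?_, ?_, ?_⟩, ?_, ?_⟩
  · intro t ht
    have h1 : HasDerivAt (fun t => p + ∫ s in (0 : ℝ)..t, (z s).2) (z t).2 t :=
      (Continuous.integral_hasStrictDerivAt (f := fun s => (z s).2) (by fun_prop)
        0 t).hasDerivAt.const_add p
    rw [← hv t ht]
    exact h1.hasDerivWithinAt.congr (fun s hs => hu s hs) (hu t ht)
  · intro T hT
    refine AbsolutelyContinuousOnInterval.fun_add
      (contDiffOn_const.absolutelyContinuousOnInterval) ?_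
    exact (hzi2.intervalIntegrable_of_real 0 T).absolutelyContinuousOnInterval_intervalIntegral
      left_mem_uIcc
  · filter_upwards [ae_restrict_of_ae (_root_.LocallyIntegrable.ae_hasDerivAt_integral hzi2), hA, hB,
      ae_restrict_mem measurableSet_Ici] with t h1 h2 h3 h4
    have := (h1 0).const_add q
    rw [← hv t h4]
    refine this.congr_deriv ?_
    simp [fs, L, L1, L2, L3, sn, h2, h3]
    ring
  · simpa using hu 0 le_rfl
  · simp

/-- The integrating factor `exp (∫ a)`. -/
theorem exists_integrating_factor {a : ℝ → ℝ} (ha : MemLp a ⊤ (volume.restrict (Ici 0))) :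
    ∃ E : ℝ → ℝ, E 0 = 1 ∧ (∀ t, 0 < E t) ∧
      (∀ T, AbsolutelyContinuousOnInterval E 0 T) ∧
      ∀ᵐ t ∂(volume.restrict (Ici 0)), HasDerivAt E (a t * E t) t := by
  obtain ⟨K, hK, A, hAm, hAK, hA⟩ := exists_bounded_measurable_rep ha
  have hloc : LocallyIntegrable A := by
    refine (continuous_const (y := K)).locallyIntegrable.mono hAm.aestronglyMeasurable ?_
    refine Filter.Eventually.of_forall fun s => ?_
    rw [Real.norm_eq_abs, Real.norm_eq_abs, abs_of_nonneg hK]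
    exact hAK s
  refine ⟨fun t => Real.exp (∫ s in (0 : ℝ)..t, A s), by simp, fun t => Real.exp_pos _,
    fun T => ?_, ?_⟩
  · exact ((hloc.intervalIntegrable_of_real 0 T).absolutelyContinuousOnInterval_intervalIntegral
      left_mem_uIcc).exp
  · filter_upwards [ae_restrict_of_ae (_root_.LocallyIntegrable.ae_hasDerivAt_integral hloc), hA] with t h1 h2
    rw [h2, mul_comm]
    exact (h1 0).exp

theorem AbsolutelyContinuousOnInterval.mono_Icc {f : ℝ → ℝ} {r s t : ℝ} (hrs : r ≤ s) (hst : s ≤ t)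
    (hf : AbsolutelyContinuousOnInterval f r t) : AbsolutelyContinuousOnInterval f s t := by
  refine hf.mono ?_
  rw [uIcc_of_le hst, uIcc_of_le (hrs.trans hst)]
  exact Icc_subset_Icc_left hrs

theorem ae_Ici_deriv {x y : ℝ → ℝ} {t₀ : ℝ}
    (h : ∀ t ≥ t₀, HasDerivWithinAt x (y t) (Ici t₀) t) :
    ∀ᵐ t ∂(volume.restrict (Ici t₀)), HasDerivAt x (y t) t := by
  have h1 : ∀ᵐ t ∂(volume.restrict (Ici t₀)), t ≠ t₀ :=
    ae_restrict_of_ae (by simp [ae_iff, measure_singleton])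
  filter_upwards [h1, ae_restrict_mem measurableSet_Ici] with t h2 h3
  exact (h t h3).hasDerivAt (Ici_mem_nhds (lt_of_le_of_ne h3 h2.symm))

theorem ac_of_deriv {x y : ℝ → ℝ} {t₀ : ℝ}
    (h : ∀ t ≥ t₀, HasDerivWithinAt x (y t) (Ici t₀) t)
    (hy : ∀ T ≥ t₀, AbsolutelyContinuousOnInterval y t₀ T) {T : ℝ} (hT : t₀ ≤ T) :
    AbsolutelyContinuousOnInterval x t₀ T := by
  refine .of_hasDerivWithinAt hT (fun r hr => (h r hr.1).mono Icc_subset_Ici_self) ?_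
  have := (hy T hT).continuousOn
  rwa [uIcc_of_le hT] at this

theorem IsHomSol.lincomb {a b u v u' v' : ℝ → ℝ} (h : IsHomSol a b u v) (h' : IsHomSol a b u' v')
    (c c' : ℝ) :
    IsHomSol a b (fun t => c * u t + c' * u' t) (fun t => c * v t + c' * v' t) where
  deriv t ht := ((h.deriv t ht).const_mul c).add ((h'.deriv t ht).const_mul c')
  ac T hT := ((h.ac T hT).const_mul c).fun_add ((h'.ac T hT).const_mul c')
  eq := by
    filter_upwards [h.eq, h'.eq] with t h1 h2
    refine ((h1.const_mul c).add (h2.const_mul c')).congr_deriv ?_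
    ring

/-- Lagrange's identity as an estimate: the increment of `E (D y - D' x)` is controlled by the
defect of `(x, y)` in the equation. -/
theorem IsHomSol.lagrange {a b D D' E x y V : ℝ → ℝ} {s t : ℝ} (hs : 0 ≤ s) (hst : s ≤ t)
    (hD : IsHomSol a b D D') (hE : ∀ T, AbsolutelyContinuousOnInterval E 0 T)
    (hE' : ∀ᵐ t ∂(volume.restrict (Ici 0)), HasDerivAt E (a t * E t) t)
    (hx : AbsolutelyContinuousOnInterval x s t) (hy : AbsolutelyContinuousOnInterval y s t)
    (hV : AbsolutelyContinuousOnInterval V s t)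
    (h : ∀ᵐ r, r ∈ Icc s t → HasDerivAt x (y r) r ∧ ∃ y' V', HasDerivAt y y' r ∧
      HasDerivAt V V' r ∧ |E r * D r| * |y' + a r * y r + b r * x r| ≤ V') :
    |E t * (D t * y t - D' t * x t) - E s * (D s * y s - D' s * x s)| ≤ V t - V s := by
  have ht : 0 ≤ t := hs.trans hst
  refine AbsolutelyContinuousOnInterval.abs_sub_le
    (f := fun r => E r * (D r * y r - D' r * x r)) hst ?_ hV ?_
  · exact ((hE t).mono_Icc hs hst).fun_mul
      (((ac_of_deriv hD.deriv hD.ac ht |>.mono_Icc hs hst).fun_mul hy).fun_sub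
        (((hD.ac t ht).mono_Icc hs hst).fun_mul hx))
  · filter_upwards [h, (ae_restrict_iff' measurableSet_Ici).1 hE',
      (ae_restrict_iff' measurableSet_Ici).1 hD.eq,
      (ae_restrict_iff' measurableSet_Ici).1 (ae_Ici_deriv hD.deriv)] with r h1 h2 h3 h4 hr
    have hr0 : r ∈ Ici (0 : ℝ) := hs.trans hr.1
    obtain ⟨h5, y', V', h6, h7, h8⟩ := h1 hr
    refine ⟨_, V', (h2 hr0).mul (((h4 hr0).mul h6).sub ((h3 hr0).mul h5)), h7, ?_⟩
    rw [← abs_mul] at h8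
    refine le_of_eq_of_le (congrArg abs ?_) h8
    ring

/-- The Cauchy function `Z` of the ordinary equation, together with the companion `Z₁` carrying
the initial position: homogeneous solutions are `Z₁ t s * x₀ + Z t s * x₀'`, and variation of
constants holds as an estimate. -/
theorem exists_cauchy_function {a b : ℝ → ℝ} (ha : MemLp a ⊤ (volume.restrict (Ici 0)))
    (hb : MemLp b ⊤ (volume.restrict (Ici 0))) :
    ∃ Z Z₁ : ℝ → ℝ → ℝ, (∀ t, ContinuousOn (Z t) (Ici 0)) ∧
      (∀ s ≥ 0, ∀ x₀ x₀', ∃ x y, IsSolution a b 0 0 id id s x₀ x₀' 0 0 x y ∧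
        ∀ t ≥ s, x t = Z₁ t s * x₀ + Z t s * x₀') ∧
      ∀ s t : ℝ, 0 ≤ s → s ≤ t → ∀ x y φ : ℝ → ℝ,
        AbsolutelyContinuousOnInterval x s t → AbsolutelyContinuousOnInterval y s t →
        ContinuousOn φ (Icc s t) →
        (∀ᵐ r, r ∈ Icc s t → HasDerivAt x (y r) r ∧ ∃ y', HasDerivAt y y' r ∧
          |y' + a r * y r + b r * x r| ≤ φ r) →
        |x t - (Z₁ t s * x s + Z t s * y s)| ≤ ∫ r in s..t, |Z t r| * φ r := by
  obtain ⟨u, v, h, hu0, hv0⟩ := exists_isHomSol ha hb 1 0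
  obtain ⟨u', v', h', hu0', hv0'⟩ := exists_isHomSol ha hb 0 1
  obtain ⟨E, hE0, -, hEac, hE⟩ := exists_integrating_factor ha
  -- Abel's formula: for two homogeneous solutions the defect vanishes, so `V = 0` is allowed and
  -- `E` times the Wronskian keeps its initial value 1.
  have hW : ∀ t ≥ 0, E t * (u t * v' t - v t * u' t) = 1 := by
    intro t ht
    have := h.lagrange (V := fun _ => 0) le_rfl ht hEac hE (ac_of_deriv h'.deriv h'.ac ht)
      (h'.ac t ht) contDiffOn_const.absolutelyContinuousOnInterval (by
        filter_upwards [(ae_restrict_iff' measurableSet_Ici).1 h'.eq,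
          (ae_restrict_iff' measurableSet_Ici).1 (ae_Ici_deriv h'.deriv)] with r h1 h2 hr
        refine ⟨h2 hr.1, _, 0, h1 hr.1, hasDerivAt_const _ _, ?_⟩
        ring_nf
        simp)
    simp only [hu0, hv0, hu0', hv0', hE0, sub_self] at this
    have := abs_nonpos_iff.1 this
    linarith
  have hcont : ∀ {w : ℝ → ℝ}, (∀ T ≥ 0, AbsolutelyContinuousOnInterval w 0 T) →
      ContinuousOn w (Ici 0) := by
    intro w hw t ht
    have h1 := (hw (t + 1) (by linarith [mem_Ici.1 ht])).continuousOn
    rw [uIcc_of_le (by linarith [mem_Ici.1 ht])] at h1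
    refine (h1 t ⟨ht, by linarith⟩).mono_of_mem_nhdsWithin ?_
    rw [← Ici_inter_Iic]
    exact inter_mem_nhdsWithin _ (Iic_mem_nhds (by linarith))
  have hZc : ∀ t, ContinuousOn (fun s => E s * (u s * u' t - u' s * u t)) (Ici 0) := by
    intro t
    have h1 := hcont fun T _ => hEac T
    have h2 := hcont fun T => ac_of_deriv h.deriv h.ac (T := T)
    have h3 := hcont fun T => ac_of_deriv h'.deriv h'.ac (T := T)
    fun_prop
  -- Primes mark the second basis solution, not derivatives. The factor `E s` is the reciprocal
  -- Wronskian at `s`.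
  refine ⟨fun t s => E s * (u s * u' t - u' s * u t),
    fun t s => -(E s * (v s * u' t - v' s * u t)), hZc, ?_, ?_⟩
  · intro s hs x₀ x₀'
    have hk := h.lincomb h' (E s * (v' s * x₀ - u' s * x₀')) (E s * (u s * x₀' - v s * x₀))
    set U := fun t => E s * (v' s * x₀ - u' s * x₀') * u t + E s * (u s * x₀' - v s * x₀) * u' t
      with hU
    set W := fun t => E s * (v' s * x₀ - u' s * x₀') * v t + E s * (u s * x₀' - v s * x₀) * v' t
      with hWdef
    -- The solution is cut off to zero before `s` to match the zero history.
    have hind : ∀ (w : ℝ → ℝ) t, s ≤ t → (Ici s).indicator w t = w t := fun w t ht =>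
      indicator_of_mem (show t ∈ Ici s from ht) w
    have hind' : ∀ (w : ℝ → ℝ) t, s < t → (Ici s).indicator w =ᶠ[nhds t] w := fun w t ht =>
      Filter.eventually_of_mem (Ici_mem_nhds ht) fun r hr => hind w r hr
    refine ⟨(Ici s).indicator U, (Ici s).indicator W, ⟨?_, ?_, ?_, ?_, ?_, ?_, ?_⟩, ?_⟩
    · intro t ht
      exact indicator_of_notMem (not_le.2 ht) _
    · intro t ht
      exact indicator_of_notMem (not_le.2 ht) _
    · rw [hind _ _ le_rfl, hU]
      linear_combination x₀ * hW s hs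
    · rw [hind _ _ le_rfl, hWdef]
      linear_combination x₀' * hW s hs
    · intro t ht
      rw [hind _ _ ht]
      exact ((hk.deriv t (hs.trans ht)).mono (Ici_subset_Ici.2 hs)).congr
        (fun r hr => hind _ r hr) (hind _ t ht)
    · intro T hT
      have h1 := (hk.ac T (hs.trans hT)).mono_Icc hs hT
      rw [absolutelyContinuousOnInterval_iff] at h1 ⊢
      intro ε hε
      obtain ⟨d, hd, h2⟩ := h1 ε hε
      refine ⟨d, hd, fun I hI hId => ?_⟩
      convert h2 I hI hId using 1
      refine Finset.sum_congr rfl fun i hi => ?_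
      have := hI.1 i hi
      rw [uIcc_of_le hT] at this
      rw [hind _ _ this.1.1, hind _ _ this.2.1]
    · have h1 : ∀ᵐ t ∂(volume.restrict (Ici s)), t ≠ s :=
        ae_restrict_of_ae (by simp [ae_iff, measure_singleton])
      filter_upwards [h1, ae_restrict_mem measurableSet_Ici,
        ae_restrict_of_ae_restrict_of_subset (Ici_subset_Ici.2 hs) hk.eq] with t h1 h2 h3
      have h4 : s < t := lt_of_le_of_ne h2 (Ne.symm h1)
      refine ⟨_, h3.congr_of_eventuallyEq (hind' _ t h4), ?_⟩
      rw [hind _ _ h4.le, hind _ _ h4.le]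
      simp
      ring
    · intro t ht
      rw [hind _ _ ht, hU]
      ring
  · intro s t hs hst x y φ hx hy hφ hode
    have ht : 0 ≤ t := hs.trans hst
    -- With `t` frozen, this solution `D` vanishes at `r = t`, where its velocity is minus the
    -- Wronskian. Hence `E (D y - D' x)` equals `x t` at `r = t` and `Z₁ t s * x s + Z t s * y s` at
    -- `r = s`.
    have hD := h.lincomb h' (u' t) (-u t)
    have hcV : ContinuousOn (fun r => |E r * (u r * u' t - u' r * u t)| * φ r) (Icc s t) :=
      (((hZc t).mono (fun r hr => hs.trans hr.1)).abs).mul hφ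
    have hiV : IntervalIntegrable (fun r => |E r * (u r * u' t - u' r * u t)| * φ r) volume s t :=
      hcV.intervalIntegrable_of_Icc hst
    have := hD.lagrange (x := x) (y := y)
      (V := fun r => ∫ r in s..r, |E r * (u r * u' t - u' r * u t)| * φ r)
      hs hst hEac hE hx hy
      (hiV.absolutelyContinuousOnInterval_intervalIntegral left_mem_uIcc) (by
        filter_upwards [hode, hiV.ae_hasDerivAt_integral] with r h1 h2 hr
        obtain ⟨h3, y', h4, h5⟩ := h1 hr
        refine ⟨h3, y', _, h4, h2 (by rwa [uIcc_of_le hst]) s left_mem_uIcc, ?_⟩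
        rw [show E r * (u' t * u r + -u t * u' r) = E r * (u r * u' t - u' r * u t) by ring]
        gcongr)
    simp only [intervalIntegral.integral_same, sub_zero] at this
    convert this using 2
    linear_combination -x t * hW t ht

/-! ### Solutions of the delay equation -/

section IsSolution

variable {a b a₁ b₁ g h : ℝ → ℝ} {t₀ x₀ x₀' : ℝ} {φ ψ x y : ℝ → ℝ}

theorem IsSolution.ac (H : IsSolution a b a₁ b₁ g h t₀ x₀ x₀' φ ψ x y) {t : ℝ} (ht : t₀ ≤ t) :
    AbsolutelyContinuousOnInterval x t₀ t :=
  ac_of_deriv H.hasDeriv H.absCont ht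

theorem IsSolution.continuousOn (H : IsSolution a b a₁ b₁ g h t₀ x₀ x₀' φ ψ x y) {t : ℝ}
    (ht : t₀ ≤ t) : ContinuousOn x (Icc t₀ t) ∧ ContinuousOn y (Icc t₀ t) := by
  have h1 := (H.ac ht).continuousOn
  have h2 := (H.absCont t ht).continuousOn
  rw [uIcc_of_le ht] at h1 h2
  exact ⟨h1, h2⟩

theorem IsSolution.ae_hasDerivAt (H : IsSolution a b a₁ b₁ g h t₀ x₀ x₀' φ ψ x y) :
    ∀ᵐ t ∂(volume.restrict (Ici t₀)), HasDerivAt x (y t) t ∧ ∃ y', HasDerivAt y y' t ∧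
      y' + a t * y t + b t * x t = -(a₁ t * y (g t) + b₁ t * x (h t)) := by
  filter_upwards [ae_Ici_deriv H.hasDeriv, H.equation] with t h1 h2
  obtain ⟨y', h3, h4⟩ := h2
  exact ⟨h1, y', h3, by linarith⟩

/-- A solution restarted at a later time, its own past being the new history. -/
theorem IsSolution.restart (H : IsSolution a b a₁ b₁ g h t₀ x₀ x₀' φ ψ x y) {s : ℝ}
    (hs : t₀ ≤ s) : IsSolution a b a₁ b₁ g h s (x s) (y s) x y x y where
  history _ _ := rfl
  history' _ _ := rfl
  init := rfl
  init' := rfl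
  hasDeriv t ht := (H.hasDeriv t (hs.trans ht)).mono (Ici_subset_Ici.2 hs)
  absCont T hT := (H.absCont T (hs.trans hT)).mono_Icc hs hT
  equation := ae_restrict_of_ae_restrict_of_subset (Ici_subset_Ici.2 hs) H.equation

end IsSolution

/-! ### The fundamental function and its integrals -/

/-- Consequences of exponential stability of the ordinary equation for its fundamental function. -/
theorem ODEExpStable.fundamental {a b : ℝ → ℝ} (ha : MemLp a ⊤ (volume.restrict (Ici 0)))
    (hb : MemLp b ⊤ (volume.restrict (Ici 0))) (hODE : ODEExpStable a b) :
    ∃ M > 0, ∃ ν > 0, (∀ t, ContinuousOn (odeFundamental a b t) (Icc 0 t)) ∧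
      (∀ s t, 0 ≤ s → s ≤ t → |odeFundamental a b t s| ≤ M * Real.exp (-ν * (t - s))) ∧
      ∀ s t : ℝ, 0 ≤ s → s ≤ t → ∀ x y φ : ℝ → ℝ,
        AbsolutelyContinuousOnInterval x s t → AbsolutelyContinuousOnInterval y s t →
        ContinuousOn φ (Icc s t) →
        (∀ᵐ r, r ∈ Icc s t → HasDerivAt x (y r) r ∧ ∃ y', HasDerivAt y y' r ∧
          |y' + a r * y r + b r * x r| ≤ φ r) →
        |x t| ≤ M * Real.exp (-ν * (t - s)) * (|x s| + |y s|)
          + ∫ r in s..t, |odeFundamental a b t r| * φ r := by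
  obtain ⟨M, hM, ν, hν, hst⟩ := hODE
  obtain ⟨Z, Z₁, hZc, hZs, hZv⟩ := exists_cauchy_function ha hb
  -- `odeFundamental` is an arbitrary choice of solution; variation of constants with `φ = 0` is the
  -- uniqueness that identifies it with `Z`.
  have hZ : ∀ s t, 0 ≤ s → s ≤ t → odeFundamental a b t s = Z t s := by
    intro s t hs hst
    obtain ⟨x, y, hxy, -⟩ := hZs s hs 0 1
    have H : ∃ x : ℝ → ℝ, ∃ y : ℝ → ℝ, IsSolution a b 0 0 id id s 0 1 0 0 x y := ⟨x, y, hxy⟩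
    obtain ⟨y', hy'⟩ := H.choose_spec
    rw [odeFundamental, dif_pos H]
    have := hZv s t hs hst H.choose y' (fun _ => 0) (hy'.ac hst) (hy'.absCont t hst)
      continuousOn_const (by
        filter_upwards [(ae_restrict_iff' measurableSet_Ici).1 hy'.ae_hasDerivAt] with r h1 hr
        obtain ⟨h2, z, h3, h4⟩ := h1 hr.1
        exact ⟨h2, z, h3, by simp [h4]⟩)
    rw [hy'.init, hy'.init'] at this
    simp only [mul_zero, intervalIntegral.integral_zero] at this
    have := abs_nonpos_iff.1 this
    linarith
  have hhom : ∀ s t, 0 ≤ s → s ≤ t → ∀ x₀ x₀' : ℝ,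
      |Z₁ t s * x₀ + Z t s * x₀'| ≤ M * Real.exp (-ν * (t - s)) * (|x₀| + |x₀'|) := by
    intro s t hs hst' x₀ x₀'
    obtain ⟨x, y, hxy, hx⟩ := hZs s hs x₀ x₀'
    have := hst s hs x₀ x₀' 0 0 measurable_const measurable_const ⟨0, by simp⟩ ⟨0, by simp⟩ x y hxy
      t hst'
    rw [hx t hst'] at this
    simpa using this
  refine ⟨M, hM, ν, hν, ?_, ?_, ?_⟩
  · intro t
    exact ((hZc t).mono Icc_subset_Ici_self).congr fun s hs => hZ s t hs.1 hs.2
  · intro s t hs hst'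
    rw [hZ s t hs hst']
    simpa using hhom s t hs hst' 0 1
  · intro s t hs hst' x y φ hx hy hφ hode
    have h1 := hZv s t hs hst' x y φ hx hy hφ hode
    have h2 := hhom s t hs hst' (x s) (y s)
    have h3 : ∫ r in s..t, |odeFundamental a b t r| * φ r = ∫ r in s..t, |Z t r| * φ r := by
      refine intervalIntegral.integral_congr fun r hr => ?_
      rw [uIcc_of_le hst'] at hr
      simp only [hZ r t (hs.trans hr.1) hr.2]
    rw [h3]
    have h4 := abs_sub_abs_le_abs_sub (x t) (Z₁ t s * x s + Z t s * y s)
    linarith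

theorem integral_exp_neg_mul_sub {c : ℝ} (hc : c ≠ 0) (s t : ℝ) :
    ∫ r in s..t, Real.exp (-c * (t - r)) = (1 - Real.exp (-c * (t - s))) / c := by
  have h : ∀ r ∈ uIcc s t,
      HasDerivAt (fun r => Real.exp (-c * (t - r)) / c) (Real.exp (-c * (t - r))) r := by
    intro r _
    have h1 : HasDerivAt (fun r => -c * (t - r)) c r := by
      simpa using ((hasDerivAt_id r).const_sub t).const_mul (-c)
    refine (h1.exp.div_const c).congr_deriv ?_
    field_simp
  rw [intervalIntegral.integral_eq_sub_of_hasDerivAt h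
    (Continuous.intervalIntegrable (by fun_prop) _ _)]
  simp
  ring

section fundamentalBound

variable {a b : ℝ → ℝ} {M ν t₀ : ℝ}

theorem lintegral_enorm_eq_ofReal_integral {f : ℝ → ℝ} {s t : ℝ} (hst : s ≤ t)
    (hf : ContinuousOn f (Icc s t)) :
    ∫⁻ r in Ioc s t, ‖f r‖ₑ = ENNReal.ofReal (∫ r in s..t, |f r|) := by
  rw [intervalIntegral.integral_of_le hst]
  exact (ofReal_integral_norm_eq_lintegral_enorm
    (hf.integrableOn_Icc.mono_set Ioc_subset_Icc_self)).symm

theorem fundamentalBound_ne_top (hν : 0 < ν) (hM : 0 < M)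
    (hc : ∀ t, ContinuousOn (odeFundamental a b t) (Icc 0 t))
    (hY : ∀ s t, 0 ≤ s → s ≤ t → |odeFundamental a b t s| ≤ M * Real.exp (-ν * (t - s)))
    (ht₀ : 0 ≤ t₀) : fundamentalBound a b t₀ ≠ ⊤ := by
  refine ne_top_of_le_ne_top (ENNReal.ofReal_ne_top (r := M / ν)) ?_
  refine iSup₂_le fun t ht => ?_
  have hct := (hc t).mono (Icc_subset_Icc_left ht₀)
  rw [lintegral_enorm_eq_ofReal_integral ht.le hct]
  refine ENNReal.ofReal_le_ofReal ?_
  calc ∫ r in t₀..t, |odeFundamental a b t r|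
      ≤ ∫ r in t₀..t, M * Real.exp (-ν * (t - r)) := by
        refine intervalIntegral.integral_mono_on ht.le
          (hct.abs.intervalIntegrable_of_Icc ht.le)
          (Continuous.intervalIntegrable (by fun_prop) _ _) fun r hr => ?_
        exact hY r t (ht₀.trans hr.1) hr.2
    _ = M * ((1 - Real.exp (-ν * (t - t₀))) / ν) := by
        rw [intervalIntegral.integral_const_mul, integral_exp_neg_mul_sub hν.ne']
    _ ≤ M * (1 / ν) := by
        gcongr
        linarith [Real.exp_pos (-ν * (t - t₀))]
    _ = M / ν := by ring

/-- Raising the lower limit only shrinks the integral, so the single constant at `t₀` serves all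
later initial times. -/
theorem integral_abs_odeFundamental_le
    (hc : ∀ t, ContinuousOn (odeFundamental a b t) (Icc 0 t))
    (hfin : fundamentalBound a b t₀ ≠ ⊤) (ht₀ : 0 ≤ t₀) {s t : ℝ} (hs : t₀ ≤ s) (hst : s ≤ t) :
    ∫ r in s..t, |odeFundamental a b t r| ≤ (fundamentalBound a b t₀).toReal := by
  -- The supremum runs over `t > t₀` only; at `t = t₀` the integral is empty.
  rcases (hs.trans hst).eq_or_lt with h | h
  · have : s = t := le_antisymm hst (h ▸ hs)
    subst this
    simp
  · refine (ENNReal.ofReal_le_iff_le_toReal hfin).1 ?_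
    rw [← lintegral_enorm_eq_ofReal_integral hst
      ((hc t).mono (Icc_subset_Icc_left (ht₀.trans hs)))]
    refine (lintegral_mono_set (Ioc_subset_Ioc_left hs)).trans ?_
    exact le_iSup₂ (f := fun t (_ : t > t₀) => ∫⁻ s in Ioc t₀ t, ‖odeFundamental a b t s‖ₑ) t h

/-- The integral of the fundamental function with a small exponential weight. -/
theorem integral_weighted_odeFundamental_le (hM : 0 < M)
    (hc : ∀ t, ContinuousOn (odeFundamental a b t) (Icc 0 t))
    (hY : ∀ s t, 0 ≤ s → s ≤ t → |odeFundamental a b t s| ≤ M * Real.exp (-ν * (t - s)))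
    (hfin : fundamentalBound a b t₀ ≠ ⊤) (ht₀ : 0 ≤ t₀) {μ : ℝ} (hμ : 0 < μ) (hμν : μ < ν)
    {s t : ℝ} (hs : t₀ ≤ s) (hst : s ≤ t) :
    ∫ r in s..t, |odeFundamental a b t r| * Real.exp (μ * (t - r))
      ≤ (fundamentalBound a b t₀).toReal + M * (1 / (ν - μ) - 1 / ν) := by
  have hct := (hc t).mono (Icc_subset_Icc_left (ht₀.trans hs))
  have hν : 0 < ν := hμ.trans hμν
  have hνμ : 0 < ν - μ := sub_pos.2 hμν
  have hi : IntervalIntegrable (fun r => |odeFundamental a b t r|) volume s t :=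
    hct.abs.intervalIntegrable_of_Icc hst
  have hi2 : IntervalIntegrable (fun r => M * (Real.exp (-(ν - μ) * (t - r)) -
      Real.exp (-ν * (t - r)))) volume s t := Continuous.intervalIntegrable (by fun_prop) _ _
  -- The exponential bound is spent only on the excess `e^{μ(t - r)} - 1` of the weight, so the
  -- estimate tends to the sharp constant as `μ → 0`.
  calc ∫ r in s..t, |odeFundamental a b t r| * Real.exp (μ * (t - r))
      ≤ ∫ r in s..t, (|odeFundamental a b t r| + M * (Real.exp (-(ν - μ) * (t - r)) -
          Real.exp (-ν * (t - r)))) := by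
        refine intervalIntegral.integral_mono_on hst ?_ (hi.add hi2) fun r hr => ?_
        · exact (hct.abs.mul (by fun_prop)).intervalIntegrable_of_Icc hst
        · have h1 := hY r t ((ht₀.trans hs).trans hr.1) hr.2
          have h2 : 1 ≤ Real.exp (μ * (t - r)) :=
            Real.one_le_exp (mul_nonneg hμ.le (sub_nonneg.2 hr.2))
          have h3 : Real.exp (-(ν - μ) * (t - r)) =
              Real.exp (-ν * (t - r)) * Real.exp (μ * (t - r)) := by
            rw [← Real.exp_add]; ring_nf
          rw [h3]
          nlinarith [mul_le_mul_of_nonneg_right h1 (sub_nonneg.2 h2)]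
    _ = (∫ r in s..t, |odeFundamental a b t r|) + M * ((1 - Real.exp (-(ν - μ) * (t - s))) /
          (ν - μ) - (1 - Real.exp (-ν * (t - s))) / ν) := by
        rw [intervalIntegral.integral_add hi hi2, intervalIntegral.integral_const_mul,
          intervalIntegral.integral_sub (Continuous.intervalIntegrable (by fun_prop) _ _)
            (Continuous.intervalIntegrable (by fun_prop) _ _),
          integral_exp_neg_mul_sub hνμ.ne', integral_exp_neg_mul_sub hν.ne']
    _ ≤ _ := by
        gcongr ?_ + M * ?_
        · exact integral_abs_odeFundamental_le hc hfin ht₀ hs hst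
        · have h1 : Real.exp (-ν * (t - s)) / ν ≤ Real.exp (-(ν - μ) * (t - s)) / (ν - μ) := by
            gcongr
            · linarith
            · linarith
          rw [sub_div, sub_div]
          linarith

end fundamentalBound

/-! ### A priori growth and first-order decay -/

section estimates

variable {a b a₁ b₁ g h : ℝ → ℝ} {t₁ x₀ x₀' N : ℝ} {φ ψ x y : ℝ → ℝ}

/-- Gronwall type a priori bound. -/
theorem IsSolution.growth {K : ℝ} (hK : 0 ≤ K)
    (hcoef : ∀ᵐ t ∂(volume.restrict (Ici 0)), |a t| ≤ K ∧ |b t| ≤ K ∧ |a₁ t| ≤ K ∧ |b₁ t| ≤ K)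
    (hg : ∀ t ≥ 0, g t ≤ t) (hh : ∀ t ≥ 0, h t ≤ t) (ht₁ : 0 ≤ t₁)
    (H : IsSolution a b a₁ b₁ g h t₁ x₀ x₀' φ ψ x y)
    (hx : ∀ s ≤ t₁, |x s| ≤ N) (hy : ∀ s ≤ t₁, |y s| ≤ N) {T : ℝ} (hT : t₁ ≤ T) :
    |x T| ≤ 3 * N * Real.exp (2 * (4 * K + 1) * (T - t₁)) ∧
      |y T| ≤ 3 * N * Real.exp (2 * (4 * K + 1) * (T - t₁)) := by
  have hN : 0 ≤ N := (abs_nonneg _).trans (hx t₁ le_rfl)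
  -- The rate `4 * K + 1` dominates both the four terms of `y'` and the single term of `x'`. The
  -- factor 2 halves the integrated bound, so the maximum satisfies `R ≤ N + (R + N) / 2`, that is
  -- `R ≤ 3 * N`.
  set l := 2 * (4 * K + 1) with hl
  have hl0 : 0 < l := by positivity
  obtain ⟨hxc, hyc⟩ := H.continuousOn hT
  obtain ⟨m, hm, hmax⟩ := isCompact_Icc.exists_isMaxOn (nonempty_Icc.2 hT)
    (f := fun s => Real.exp (-(l * (s - t₁))) * max |x s| |y s|)
    ((Continuous.continuousOn (by fun_prop)).mul (hxc.abs.sup hyc.abs))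
  set R := Real.exp (-(l * (m - t₁))) * max |x m| |y m| with hR
  have hR0 : 0 ≤ R := by positivity
  have hbd : ∀ s ∈ Icc t₁ T, max |x s| |y s| ≤ R * Real.exp (l * (s - t₁)) := by
    intro s hs
    have h1 : Real.exp (-(l * (s - t₁))) * max |x s| |y s| ≤ R := hmax hs
    rwa [Real.exp_neg, inv_mul_le_iff₀ (Real.exp_pos _), mul_comm] at h1
  have hbd' : ∀ r ∈ Icc t₁ T, ∀ s ≤ r, |x s| ≤ (R + N) * Real.exp (l * (r - t₁)) ∧
      |y s| ≤ (R + N) * Real.exp (l * (r - t₁)) := by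
    intro r hr s hs
    have h1 : 1 ≤ Real.exp (l * (r - t₁)) :=
      Real.one_le_exp (mul_nonneg hl0.le (sub_nonneg.2 hr.1))
    rcases le_or_gt s t₁ with h2 | h2
    · have h3 : N ≤ (R + N) * Real.exp (l * (r - t₁)) := by nlinarith
      exact ⟨(hx s h2).trans h3, (hy s h2).trans h3⟩
    · have h3 : R * Real.exp (l * (s - t₁)) ≤ (R + N) * Real.exp (l * (r - t₁)) := by
        gcongr
        linarith
      have h4 := (hbd s ⟨h2.le, hs.trans hr.2⟩).trans h3
      exact ⟨(le_max_left _ _).trans h4, (le_max_right _ _).trans h4⟩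
  have hV : ∀ r, HasDerivAt (fun r => (R + N) / 2 * Real.exp (l * (r - t₁)))
      ((4 * K + 1) * ((R + N) * Real.exp (l * (r - t₁)))) r := by
    intro r
    have h1 : HasDerivAt (fun r => l * (r - t₁)) l r := by
      simpa using ((hasDerivAt_id r).sub_const t₁).const_mul l
    refine (h1.exp.const_mul ((R + N) / 2)).congr_deriv ?_
    rw [hl]
    ring
  have hVac : AbsolutelyContinuousOnInterval (fun r => (R + N) / 2 * Real.exp (l * (r - t₁)))
      t₁ m := ContDiffOn.absolutelyContinuousOnInterval (by fun_prop)
  have hcoef' := (ae_restrict_iff' measurableSet_Ici).1 hcoef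
  have hder := (ae_restrict_iff' measurableSet_Ici).1 H.ae_hasDerivAt
  have hxm := AbsolutelyContinuousOnInterval.abs_sub_le hm.1 (H.ac hm.1) hVac (by
    filter_upwards [hder] with r h1 hr
    have hrT : r ∈ Icc t₁ T := ⟨hr.1, hr.2.trans hm.2⟩
    refine ⟨_, _, (h1 hr.1).1, hV r, ((hbd' r hrT r le_rfl).2).trans ?_⟩
    refine le_mul_of_one_le_left (by positivity) (by linarith))
  have hym := AbsolutelyContinuousOnInterval.abs_sub_le hm.1 (H.absCont m hm.1) hVac (by
    filter_upwards [hder, hcoef'] with r h1 h2 hr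
    have hrT : r ∈ Icc t₁ T := ⟨hr.1, hr.2.trans hm.2⟩
    have hr0 : 0 ≤ r := ht₁.trans hr.1
    obtain ⟨-, y', h3, h4⟩ := h1 hr.1
    obtain ⟨ha, hb, ha₁, hb₁⟩ := h2 hr0
    refine ⟨y', _, h3, hV r, ?_⟩
    set B := (R + N) * Real.exp (l * (r - t₁))
    have hB : 0 ≤ B := by positivity
    have e1 : |a r * y r| ≤ K * B := by
      rw [abs_mul]; exact mul_le_mul ha (hbd' r hrT r le_rfl).2 (abs_nonneg _) hK
    have e2 : |b r * x r| ≤ K * B := by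
      rw [abs_mul]; exact mul_le_mul hb (hbd' r hrT r le_rfl).1 (abs_nonneg _) hK
    have e3 : |a₁ r * y (g r)| ≤ K * B := by
      rw [abs_mul]; exact mul_le_mul ha₁ (hbd' r hrT _ (hg r hr0)).2 (abs_nonneg _) hK
    have e4 : |b₁ r * x (h r)| ≤ K * B := by
      rw [abs_mul]; exact mul_le_mul hb₁ (hbd' r hrT _ (hh r hr0)).1 (abs_nonneg _) hK
    rw [abs_le] at *
    constructor <;> linarith)
  have hexp : 1 ≤ Real.exp (l * (m - t₁)) :=
    Real.one_le_exp (mul_nonneg hl0.le (sub_nonneg.2 hm.1))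
  have hkey : max |x m| |y m| ≤ (N + (R + N) / 2) * Real.exp (l * (m - t₁)) := by
    have h1 := hx t₁ le_rfl
    have h2 := hy t₁ le_rfl
    have h3 := abs_sub_abs_le_abs_sub (x m) (x t₁)
    have h4 := abs_sub_abs_le_abs_sub (y m) (y t₁)
    simp only [sub_self, mul_zero, Real.exp_zero] at hxm hym
    have h5 : N ≤ N * Real.exp (l * (m - t₁)) := le_mul_of_one_le_right hN hexp
    refine max_le ?_ ?_ <;> linarith
  have hRle : R ≤ N + (R + N) / 2 := by
    have h1 : R * Real.exp (l * (m - t₁)) = max |x m| |y m| := by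
      rw [hR, Real.exp_neg]
      field_simp
    exact le_of_mul_le_mul_right (h1.le.trans hkey) (Real.exp_pos _)
  have hfin : max |x T| |y T| ≤ 3 * N * Real.exp (l * (T - t₁)) :=
    (hbd T ⟨hT, le_rfl⟩).trans (by gcongr; linarith)
  exact ⟨(le_max_left _ _).trans hfin, (le_max_right _ _).trans hfin⟩

/-- If `y' + a y = F` with `|F| ≤ G a e^{-μ(t-t₁)}`, `a ≥ α > μ`, then `y` decays at the rate `μ`,
with gain `α / (α - μ)`. -/
theorem first_order_decay {y a : ℝ → ℝ} {t₁ t α μ G : ℝ} (ht₁ : 0 ≤ t₁) (ht : t₁ ≤ t)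
    (ha : MemLp a ⊤ (volume.restrict (Ici 0))) (hμ : 0 < μ) (hμα : μ < α) (hG : 0 ≤ G)
    (hy : AbsolutelyContinuousOnInterval y t₁ t)
    (h : ∀ᵐ r, r ∈ Icc t₁ t → α ≤ a r ∧ ∃ y', HasDerivAt y y' r ∧
      |y' + a r * y r| ≤ a r * (G * Real.exp (-(μ * (r - t₁))))) :
    |y t| ≤ (|y t₁| + α / (α - μ) * G) * Real.exp (-(μ * (t - t₁))) := by
  obtain ⟨E, -, hE0, hEac, hE⟩ := exists_integrating_factor ha
  have hαμ : 0 < α - μ := sub_pos.2 hμα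
  have hEt := (hEac t).mono_Icc ht₁ ht
  have hw : ∀ r, HasDerivAt (fun r => Real.exp (-(μ * (r - t₁))))
      (-μ * Real.exp (-(μ * (r - t₁)))) r := by
    intro r
    have h1 : HasDerivAt (fun r => -(μ * (r - t₁))) (-μ) r := by
      simpa using (((hasDerivAt_id r).sub_const t₁).const_mul μ).fun_neg
    refine h1.exp.congr_deriv (by ring)
  have hVac : AbsolutelyContinuousOnInterval (fun r => E r * Real.exp (-(μ * (r - t₁)))) t₁ t :=
    hEt.fun_mul (ContDiffOn.absolutelyContinuousOnInterval (by fun_prop))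
  have hE' := (ae_restrict_iff' measurableSet_Ici).1 hE
  -- Comparison with a constant shows that `E r * e^{-μ(r - t₁)}` does not decrease, since `a ≥ α >
  -- μ`; this transports the initial value to time `t`.
  have hmono := AbsolutelyContinuousOnInterval.abs_sub_le (f := fun _ => 0) ht
    contDiffOn_const.absolutelyContinuousOnInterval hVac (by
      filter_upwards [h, hE'] with r h1 h2 hr
      have hr0 : r ∈ Ici (0 : ℝ) := ht₁.trans hr.1
      refine ⟨0, _, hasDerivAt_const _ _, (h2 hr0).mul (hw r), ?_⟩
      have h3 : 0 ≤ (a r - μ) * (E r * Real.exp (-(μ * (r - t₁)))) :=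
        mul_nonneg (by linarith [(h1 hr).1]) (mul_nonneg (hE0 r).le (Real.exp_pos _).le)
      rw [abs_zero]
      linarith)
  have hcmp := AbsolutelyContinuousOnInterval.abs_sub_le (f := fun r => E r * y r) ht
    (hEt.fun_mul hy) (hVac.const_mul (α / (α - μ) * G)) (by
      filter_upwards [h, hE'] with r h1 h2 hr
      have hr0 : r ∈ Ici (0 : ℝ) := ht₁.trans hr.1
      obtain ⟨h3, y', h4, h5⟩ := h1 hr
      refine ⟨_, _, (h2 hr0).mul h4, ((h2 hr0).mul (hw r)).const_mul _, ?_⟩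
      -- Since `a / (a - μ)` decreases in `a`, its worst value is at `a = α`. The factor `a r - μ`
      -- is the logarithmic derivative of the comparison function.
      have h6 : a r ≤ α / (α - μ) * (a r - μ) := by
        rw [div_mul_eq_mul_div, le_div_iff₀ hαμ]
        nlinarith
      calc |a r * E r * y r + E r * y'| = E r * |y' + a r * y r| := by
            rw [← abs_of_pos (hE0 r), ← abs_mul, abs_of_pos (hE0 r)]
            congr 1
            ring
        _ ≤ E r * (α / (α - μ) * (a r - μ) * (G * Real.exp (-(μ * (r - t₁))))) :=
            mul_le_mul_of_nonneg_left (h5.trans (by gcongr)) (hE0 r).le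
        _ = _ := by ring)
  simp only [sub_self, mul_zero, neg_zero, Real.exp_zero, abs_zero, mul_one] at hmono hcmp
  have h1 := abs_sub_abs_le_abs_sub (E t * y t) (E t₁ * y t₁)
  rw [abs_mul, abs_mul, abs_of_pos (hE0 t), abs_of_pos (hE0 t₁)] at h1
  have h2 : E t₁ * |y t₁| ≤ E t * Real.exp (-(μ * (t - t₁))) * |y t₁| :=
    mul_le_mul_of_nonneg_right (by linarith) (abs_nonneg _)
  have h3 : 0 ≤ α / (α - μ) * G * E t₁ :=
    mul_nonneg (mul_nonneg (div_nonneg (by linarith) hαμ.le) hG) (hE0 t₁).le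
  refine le_of_mul_le_mul_left ?_ (hE0 t)
  linarith

end estimates

/-- The closing inequality of the coupled weighted estimates. -/
theorem coupled_bound {P Q N M Ym A B k p q r d : ℝ}
    (hYm : 0 ≤ Ym) (hA : 0 ≤ A) (hd : 0 ≤ d)
    (hc : k * q * d < 1) (hF : Ym * (A * d * (k * (p + r * d)) / (1 - k * q * d) + B * d) < 1)
    (hQ : Q ≤ N + k * (p * P + q * d * (Q + N) + r * d * (P + N)))
    (hP : P ≤ M * (2 * N) + Ym * (A * d * (Q + N) + B * d * (P + N))) :
    P ≤ (2 * M + Ym * (A * d * ((1 + k * q * d + k * r * d) / (1 - k * q * d)) + A * d + B * d)) /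
      (1 - Ym * (A * d * (k * (p + r * d)) / (1 - k * q * d) + B * d)) * N := by
  have hc' : 0 < 1 - k * q * d := sub_pos.2 hc
  have hQ' : Q ≤ (k * (p + r * d) * P + (1 + k * q * d + k * r * d) * N) / (1 - k * q * d) := by
    rw [le_div_iff₀ hc']
    linarith
  rw [div_mul_eq_mul_div, le_div_iff₀ (sub_pos.2 hF)]
  have h1 : Ym * (A * d) * Q ≤ Ym * (A * d) *
      ((k * (p + r * d) * P + (1 + k * q * d + k * r * d) * N) / (1 - k * q * d)) :=
    mul_le_mul_of_nonneg_left hQ' (by positivity)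
  have h2 : Ym * (A * d) *
      ((k * (p + r * d) * P + (1 + k * q * d + k * r * d) * N) / (1 - k * q * d)) =
      Ym * (A * d * (k * (p + r * d)) / (1 - k * q * d)) * P +
      Ym * (A * d * ((1 + k * q * d + k * r * d) / (1 - k * q * d))) * N := by ring
  linarith

/-! ### Weighted decay from time `t₀` on -/

section decay

variable {a b a₁ b₁ g h : ℝ → ℝ}

/-- The weighted estimate: with all gains at the weight `μ` small enough, solutions starting at or
after `t₀` decay at the rate `μ`. -/
theorem IsSolution.decay {t₀ α A B p q r D μ ν M Ym : ℝ} (ht₀ : 0 ≤ t₀)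
    (ha : MemLp a ⊤ (volume.restrict (Ici 0)))
    (hA : 0 ≤ A) (hB : 0 ≤ B) (hp : 0 ≤ p) (hq : 0 ≤ q) (hr : 0 ≤ r)
    (hcoef : ∀ᵐ t ∂(volume.restrict (Ici t₀)), α ≤ a t ∧ |a₁ t| ≤ A ∧ |b₁ t| ≤ B ∧
      |b t| ≤ p * a t ∧ |a₁ t| ≤ q * a t ∧ |b₁ t| ≤ r * a t)
    (hg : ∀ t ≥ 0, g t ≤ t) (hh : ∀ t ≥ 0, h t ≤ t)
    (hgD : ∀ t ≥ 0, t - g t ≤ D) (hhD : ∀ t ≥ 0, t - h t ≤ D)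
    (hμ : 0 < μ) (hμα : μ < α) (hμν : μ < ν) (hM : 0 < M)
    (hvoc : ∀ s t : ℝ, 0 ≤ s → s ≤ t → ∀ x y φ : ℝ → ℝ,
      AbsolutelyContinuousOnInterval x s t → AbsolutelyContinuousOnInterval y s t →
      ContinuousOn φ (Icc s t) →
      (∀ᵐ r, r ∈ Icc s t → HasDerivAt x (y r) r ∧ ∃ y', HasDerivAt y y' r ∧
        |y' + a r * y r + b r * x r| ≤ φ r) →
      |x t| ≤ M * Real.exp (-ν * (t - s)) * (|x s| + |y s|)
        + ∫ r in s..t, |odeFundamental a b t r| * φ r)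
    (hYm : 0 ≤ Ym) (hY : ∀ s t, t₀ ≤ s → s ≤ t →
      ∫ r in s..t, |odeFundamental a b t r| * Real.exp (μ * (t - r)) ≤ Ym)
    (hcq : α / (α - μ) * q * Real.exp (μ * D) < 1)
    (hF : Ym * (A * Real.exp (μ * D) * (α / (α - μ) * (p + r * Real.exp (μ * D))) /
      (1 - α / (α - μ) * q * Real.exp (μ * D)) + B * Real.exp (μ * D)) < 1) :
    ∃ C ≥ 0, ∀ (t₁ x₀ x₀' N : ℝ) (φ ψ x y : ℝ → ℝ), t₀ ≤ t₁ →
      IsSolution a b a₁ b₁ g h t₁ x₀ x₀' φ ψ x y →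
      (∀ s ≤ t₁, |x s| ≤ N) → (∀ s ≤ t₁, |y s| ≤ N) →
      ∀ T ≥ t₁, |x T| ≤ C * N * Real.exp (-(μ * (T - t₁))) := by
  set d := Real.exp (μ * D) with hd
  set k := α / (α - μ) with hk
  have hd0 : 0 < d := Real.exp_pos _
  have hk0 : 0 < k := div_pos (hμ.trans hμα) (sub_pos.2 hμα)
  have hcq' : 0 < 1 - k * q * d := sub_pos.2 hcq
  refine ⟨(2 * M + Ym * (A * d * ((1 + k * q * d + k * r * d) / (1 - k * q * d)) + A * d + B * d)) /
      (1 - Ym * (A * d * (k * (p + r * d)) / (1 - k * q * d) + B * d)),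
    div_nonneg (by positivity) (sub_pos.2 hF).le, fun t₁ x₀ x₀' N φ ψ x y ht₁ H hx hy T hT => ?_⟩
  have hN : 0 ≤ N := (abs_nonneg _).trans (hx t₁ le_rfl)
  have ht₁0 : 0 ≤ t₁ := ht₀.trans ht₁
  obtain ⟨hxc, hyc⟩ := H.continuousOn hT
  have hwc : ContinuousOn (fun s => Real.exp (μ * (s - t₁))) (Icc t₁ T) :=
    Continuous.continuousOn (by fun_prop)
  -- Maxima over the compact `[t₁, T]` are finite without any prior decay, which is what permits
  -- absorbing `P` and `Q`; the final constant is free of `T`.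
  obtain ⟨m, hm, hmax⟩ := isCompact_Icc.exists_isMaxOn (nonempty_Icc.2 hT) (hwc.mul hxc.abs)
  obtain ⟨n, hn, hnax⟩ := isCompact_Icc.exists_isMaxOn (nonempty_Icc.2 hT) (hwc.mul hyc.abs)
  set P := Real.exp (μ * (m - t₁)) * |x m| with hP
  set Q := Real.exp (μ * (n - t₁)) * |y n| with hQ
  have hP0 : 0 ≤ P := by positivity
  have hQ0 : 0 ≤ Q := by positivity
  have hxP : ∀ s ∈ Icc t₁ T, |x s| ≤ P * Real.exp (-(μ * (s - t₁))) := by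
    intro s hs
    have h1 : Real.exp (μ * (s - t₁)) * |x s| ≤ P := hmax hs
    rwa [Real.exp_neg, ← div_eq_mul_inv, le_div_iff₀ (Real.exp_pos _), mul_comm]
  have hyQ : ∀ s ∈ Icc t₁ T, |y s| ≤ Q * Real.exp (-(μ * (s - t₁))) := by
    intro s hs
    have h1 : Real.exp (μ * (s - t₁)) * |y s| ≤ Q := hnax hs
    rwa [Real.exp_neg, ← div_eq_mul_inv, le_div_iff₀ (Real.exp_pos _), mul_comm]
  -- Looking back by at most `D` costs the factor `d = e^{μD}`. The summand `N` covers arguments in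
  -- the history, where the weight `e^{-μ(s - t₁)}` is at least 1.
  have hdelay : ∀ (w : ℝ → ℝ) (W : ℝ), 0 ≤ W → (∀ s ≤ t₁, |w s| ≤ N) →
      (∀ s ∈ Icc t₁ T, |w s| ≤ W * Real.exp (-(μ * (s - t₁)))) →
      ∀ r ∈ Icc t₁ T, ∀ s ≤ r, r - s ≤ D →
        |w s| ≤ d * (W + N) * Real.exp (-(μ * (r - t₁))) := by
    intro w W hW hw hwW r hr s hs hsD
    have h1 : |w s| ≤ (W + N) * Real.exp (-(μ * (s - t₁))) := by
      rcases le_or_gt s t₁ with h2 | h2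
      · have h3 : 1 ≤ Real.exp (-(μ * (s - t₁))) := Real.one_le_exp (by nlinarith)
        have := hw s h2
        nlinarith
      · refine (hwW s ⟨h2.le, hs.trans hr.2⟩).trans ?_
        gcongr
        linarith
    refine h1.trans ?_
    have h4 : Real.exp (-(μ * (s - t₁))) ≤ d * Real.exp (-(μ * (r - t₁))) := by
      rw [hd, ← Real.exp_add]
      gcongr
      nlinarith
    calc _ ≤ (W + N) * (d * Real.exp (-(μ * (r - t₁)))) := by gcongr
      _ = _ := by ring
  have hder := (ae_restrict_iff' measurableSet_Ici).1 H.ae_hasDerivAt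
  have hcoef' := (ae_restrict_iff' measurableSet_Ici).1 hcoef
  have hQle : Q ≤ N + k * (p * P + q * d * (Q + N) + r * d * (P + N)) := by
    have h1 := first_order_decay (y := y) (G := p * P + q * d * (Q + N) + r * d * (P + N))
      ht₁0 hn.1 ha hμ hμα (by positivity) (H.absCont n hn.1) (by
        filter_upwards [hder, hcoef'] with s h1 h2 hs
        have hsT : s ∈ Icc t₁ T := ⟨hs.1, hs.2.trans hn.2⟩
        have hs0 : 0 ≤ s := ht₁0.trans hs.1
        obtain ⟨-, y', h3, h4⟩ := h1 hs.1
        obtain ⟨c1, -, -, c2, c3, c4⟩ := h2 (ht₁.trans hs.1)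
        refine ⟨c1, y', h3, ?_⟩
        have has : 0 ≤ a s := by linarith
        set e := Real.exp (-(μ * (s - t₁)))
        have e1 : |b s * x s| ≤ p * a s * (P * e) := by
          rw [abs_mul]
          exact mul_le_mul c2 (hxP s hsT) (abs_nonneg _) (by positivity)
        have e2 : |a₁ s * y (g s)| ≤ q * a s * (d * (Q + N) * e) := by
          rw [abs_mul]
          exact mul_le_mul c3 (hdelay y Q hQ0 hy hyQ s hsT _ (hg s hs0) (hgD s hs0))
            (abs_nonneg _) (by positivity)
        have e3 : |b₁ s * x (h s)| ≤ r * a s * (d * (P + N) * e) := by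
          rw [abs_mul]
          exact mul_le_mul c4 (hdelay x P hP0 hx hxP s hsT _ (hh s hs0) (hhD s hs0))
            (abs_nonneg _) (by positivity)
        rw [abs_le] at *
        constructor <;> linarith)
    have h2 := hy t₁ le_rfl
    rw [Real.exp_neg, ← div_eq_mul_inv, le_div_iff₀ (Real.exp_pos _), mul_comm] at h1
    linarith
  have hPle : P ≤ M * (2 * N) + Ym * (A * d * (Q + N) + B * d * (P + N)) := by
    set G := A * d * (Q + N) + B * d * (P + N) with hG
    have hG0 : 0 ≤ G := by positivity
    have h1 := hvoc t₁ m ht₁0 hm.1 x y (fun s => G * Real.exp (-(μ * (s - t₁)))) (H.ac hm.1)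
      (H.absCont m hm.1) (Continuous.continuousOn (by fun_prop)) (by
        filter_upwards [hder, hcoef'] with s h1 h2 hs
        have hsT : s ∈ Icc t₁ T := ⟨hs.1, hs.2.trans hm.2⟩
        have hs0 : 0 ≤ s := ht₁0.trans hs.1
        obtain ⟨h5, y', h3, h4⟩ := h1 hs.1
        obtain ⟨-, c1, c2, -⟩ := h2 (ht₁.trans hs.1)
        refine ⟨h5, y', h3, ?_⟩
        rw [h4, abs_neg]
        set e := Real.exp (-(μ * (s - t₁)))
        have e2 : |a₁ s * y (g s)| ≤ A * (d * (Q + N) * e) := by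
          rw [abs_mul]
          exact mul_le_mul c1 (hdelay y Q hQ0 hy hyQ s hsT _ (hg s hs0) (hgD s hs0))
            (abs_nonneg _) hA
        have e3 : |b₁ s * x (h s)| ≤ B * (d * (P + N) * e) := by
          rw [abs_mul]
          exact mul_le_mul c2 (hdelay x P hP0 hx hxP s hsT _ (hh s hs0) (hhD s hs0))
            (abs_nonneg _) hB
        refine (abs_add_le _ _).trans ((add_le_add e2 e3).trans (le_of_eq ?_))
        rw [hG]
        ring)
    -- Splitting `e^{-μ(s - t₁)}` pulls out the decay at `m` and leaves the weighted kernel bounded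
    -- by `Ym`.
    have h2 : ∫ s in t₁..m, |odeFundamental a b m s| * (G * Real.exp (-(μ * (s - t₁)))) =
        Real.exp (-(μ * (m - t₁))) * G *
          ∫ s in t₁..m, |odeFundamental a b m s| * Real.exp (μ * (m - s)) := by
      rw [← intervalIntegral.integral_const_mul]
      refine intervalIntegral.integral_congr fun s _ => ?_
      have : Real.exp (-(μ * (s - t₁))) =
          Real.exp (-(μ * (m - t₁))) * Real.exp (μ * (m - s)) := by
        rw [← Real.exp_add]
        ring_nf
      simp only [this]
      ring
    have h3 : Real.exp (-ν * (m - t₁)) ≤ Real.exp (-(μ * (m - t₁))) := by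
      gcongr
      nlinarith [hm.1]
    have h4 : |x m| ≤ (M * (2 * N) + Ym * G) * Real.exp (-(μ * (m - t₁))) := by
      rw [h2] at h1
      have h5 : M * Real.exp (-ν * (m - t₁)) * (|x t₁| + |y t₁|) ≤
          M * Real.exp (-(μ * (m - t₁))) * (2 * N) := by
        gcongr
        linarith [hx t₁ le_rfl, hy t₁ le_rfl]
      have h6 := mul_le_mul_of_nonneg_left (hY t₁ m ht₁ hm.1)
        (mul_nonneg (Real.exp_pos (-(μ * (m - t₁)))).le hG0)
      linarith
    rw [Real.exp_neg, ← div_eq_mul_inv, le_div_iff₀ (Real.exp_pos _), mul_comm] at h4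
    exact h4
  exact (hxP T ⟨hT, le_rfl⟩).trans (mul_le_mul_of_nonneg_right
    (coupled_bound hYm hA hd0.le hcq hF hQle hPle) (Real.exp_pos _).le)

/-- A strict inequality between the gains survives a small exponential weight. -/
theorem exists_small_weight {Y M ν α A B p q r D : ℝ} (hν : 0 < ν) (hα : 0 < α) (hq : q < 1)
    (hmain : Y * (A * (p + r) / (1 - q) + B) < 1) :
    ∃ μ > 0, μ < α ∧ μ < ν ∧ α / (α - μ) * q * Real.exp (μ * D) < 1 ∧
      (Y + M * (1 / (ν - μ) - 1 / ν)) *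
        (A * Real.exp (μ * D) * (α / (α - μ) * (p + r * Real.exp (μ * D))) /
          (1 - α / (α - μ) * q * Real.exp (μ * D)) + B * Real.exp (μ * D)) < 1 := by
  have hk : ContinuousAt (fun μ : ℝ => α / (α - μ)) 0 :=
    ContinuousAt.div (by fun_prop) (by fun_prop) (by simpa using hα.ne')
  have hd : ContinuousAt (fun μ : ℝ => Real.exp (μ * D)) 0 := by fun_prop
  have hi : ContinuousAt (fun μ : ℝ => 1 / (ν - μ)) 0 :=
    ContinuousAt.div (by fun_prop) (by fun_prop) (by simpa using hν.ne')
  have hkq : ContinuousAt (fun μ : ℝ => α / (α - μ) * q * Real.exp (μ * D)) 0 := by fun_prop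
  have hkq0 : α / (α - 0) * q * Real.exp (0 * D) = q := by simp [hα.ne']
  have hF : ContinuousAt (fun μ : ℝ => (Y + M * (1 / (ν - μ) - 1 / ν)) *
        (A * Real.exp (μ * D) * (α / (α - μ) * (p + r * Real.exp (μ * D))) /
          (1 - α / (α - μ) * q * Real.exp (μ * D)) + B * Real.exp (μ * D))) 0 := by
    refine ContinuousAt.mul (by fun_prop) (ContinuousAt.add (ContinuousAt.div (by fun_prop)
      (by fun_prop) ?_) (by fun_prop))
    rw [hkq0]
    exact (sub_pos.2 hq).ne'
  have e1 := hkq.eventually_lt_const (u := 1) (hkq0.trans_lt hq)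
  have e2 := hF.eventually_lt_const (u := 1) (by simpa [hα.ne'] using hmain)
  have e3 : ∀ᶠ μ : ℝ in nhds 0, μ < α ∧ μ < ν :=
    (eventually_lt_nhds hα).and (eventually_lt_nhds hν)
  obtain ⟨μ, ⟨⟨h1, h2⟩, h3, h4⟩, h5⟩ :=
    ((((e1.and e2).and e3).filter_mono nhdsWithin_le_nhds).and
      (self_mem_nhdsWithin (a := (0 : ℝ)) (s := Ioi 0))).exists
  exact ⟨μ, h5, h3, h4, h1, h2⟩

end decay

/-! ### Passage to real constants and to all initial times -/

theorem theorem4 (a b a₁ b₁ g h : ℝ → ℝ)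
    -- measurable, essentially bounded coefficients on [0, ∞)
    (ha : MemLp a ⊤ (volume.restrict (Ici 0)))
    (hb : MemLp b ⊤ (volume.restrict (Ici 0)))
    (ha₁ : MemLp a₁ ⊤ (volume.restrict (Ici 0)))
    (hb₁ : MemLp b₁ ⊤ (volume.restrict (Ici 0)))
    -- Lebesgue measurable bounded delays
    (hg : AEMeasurable g (volume.restrict (Ici 0)))
    (hh : AEMeasurable h (volume.restrict (Ici 0)))
    (hg_le : ∀ t ≥ 0, g t ≤ t) (hh_le : ∀ t ≥ 0, h t ≤ t)
    (δ τ : ℝ) (hδ : ∀ t ≥ 0, t - g t ≤ δ) (hτ : ∀ t ≥ 0, t - h t ≤ τ)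
    (α : ℝ) (hα : 0 < α) (haα : ∀ᵐ t ∂(volume.restrict (Ici (0 : ℝ))), α ≤ a t)
    (hODE : ODEExpStable a b)
    (t₀ : ℝ) (ht₀ : 0 ≤ t₀)
    (hlt : normInf t₀ (a₁ / a) < 1)
    (hmain : fundamentalBound a b t₀ *
      (normInf t₀ a₁ * (normInf t₀ (b / a) + normInf t₀ (b₁ / a)) / (1 - normInf t₀ (a₁ / a))
        + normInf t₀ b₁) < 1) :
    ExpStable a b a₁ b₁ g h := by
  obtain ⟨M, hM, ν, hν, hYc, hYb, hvoc⟩ := hODE.fundamental ha hb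
  have hYfin := fundamentalBound_ne_top hν hM hYc hYb ht₀
  have hsub : Ici t₀ ⊆ Ici (0 : ℝ) := Ici_subset_Ici.2 ht₀
  have hres : volume.restrict (Ici t₀) ≤ volume.restrict (Ici (0 : ℝ)) :=
    Measure.restrict_mono_set _ hsub
  -- finiteness of the norms
  have haα' := ae_restrict_of_ae_restrict_of_subset hsub haα
  have hfin : ∀ f : ℝ → ℝ, MemLp f ⊤ (volume.restrict (Ici 0)) → normInf t₀ f ≠ ⊤ := fun f hf =>
    (hf.mono_measure hres).2.ne
  have hfin' : ∀ f : ℝ → ℝ, MemLp f ⊤ (volume.restrict (Ici 0)) → normInf t₀ (f / a) ≠ ⊤ := by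
    intro f hf
    rw [normInf, eLpNorm_exponent_top]
    refine (eLpNormEssSup_lt_top_of_ae_bound (C := (normInf t₀ f).toReal / α) ?_).ne
    filter_upwards [ae_abs_le_toReal_eLpNorm (hfin f hf), haα'] with t h1 h2
    rw [Pi.div_apply, norm_div, Real.norm_eq_abs, Real.norm_eq_abs,
      abs_of_pos (hα.trans_le h2)]
    exact div_le_div₀ ENNReal.toReal_nonneg h1 hα h2
  have hquot : ∀ f : ℝ → ℝ, MemLp f ⊤ (volume.restrict (Ici 0)) →
      ∀ᵐ t ∂(volume.restrict (Ici t₀)), |f t| ≤ (normInf t₀ (f / a)).toReal * a t := by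
    intro f hf
    filter_upwards [ae_abs_le_toReal_eLpNorm (hfin' f hf), haα'] with t h1 h2
    have h3 := hα.trans_le h2
    rwa [Pi.div_apply, abs_div, abs_of_pos h3, div_le_iff₀ h3] at h1
  -- the hypotheses in terms of real numbers
  have hq : (normInf t₀ (a₁ / a)).toReal < 1 := by
    have := (ENNReal.toReal_lt_toReal hlt.ne_top ENNReal.one_ne_top).2 hlt
    simpa using this
  have hmain' : (fundamentalBound a b t₀).toReal * ((normInf t₀ a₁).toReal *
      ((normInf t₀ (b / a)).toReal + (normInf t₀ (b₁ / a)).toReal) /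
        (1 - (normInf t₀ (a₁ / a)).toReal) + (normInf t₀ b₁).toReal) < 1 := by
    have h1 := (ENNReal.toReal_lt_toReal hmain.ne_top ENNReal.one_ne_top).2 hmain
    -- Subtraction in `ENNReal` truncates; by `hlt` it is the true difference, and positive, so the
    -- quotient is finite.
    have h2 : (1 - normInf t₀ (a₁ / a)) ≠ 0 := (tsub_pos_of_lt hlt).ne'
    rw [ENNReal.toReal_mul, ENNReal.toReal_add (ENNReal.div_ne_top (ENNReal.mul_ne_top (hfin _ ha₁)
      (ENNReal.add_ne_top.2 ⟨hfin' _ hb, hfin' _ hb₁⟩)) h2) (hfin _ hb₁), ENNReal.toReal_div,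
      ENNReal.toReal_mul, ENNReal.toReal_add (hfin' _ hb) (hfin' _ hb₁),
      ENNReal.toReal_sub_of_le hlt.le ENNReal.one_ne_top, ENNReal.toReal_one] at h1
    exact h1
  obtain ⟨μ, hμ, hμα, hμν, hcq, hF⟩ :=
    exists_small_weight (M := M) (D := max δ τ) hν hα hq hmain'
  have hYm0 : 0 ≤ (fundamentalBound a b t₀).toReal + M * (1 / (ν - μ) - 1 / ν) := by
    have h1 : 1 / ν ≤ 1 / (ν - μ) := by
      gcongr
      · linarith
    have h2 : 0 ≤ M * (1 / (ν - μ) - 1 / ν) := mul_nonneg hM.le (sub_nonneg.2 h1)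
    have h3 : 0 ≤ (fundamentalBound a b t₀).toReal := ENNReal.toReal_nonneg
    linarith
  obtain ⟨C, hC, hdecay⟩ := IsSolution.decay (a₁ := a₁) (b₁ := b₁) (g := g) (h := h)
    ht₀ ha ENNReal.toReal_nonneg ENNReal.toReal_nonneg ENNReal.toReal_nonneg
    ENNReal.toReal_nonneg ENNReal.toReal_nonneg (by
      filter_upwards [haα', ae_abs_le_toReal_eLpNorm (hfin _ ha₁),
        ae_abs_le_toReal_eLpNorm (hfin _ hb₁), hquot _ hb, hquot _ ha₁, hquot _ hb₁]
        with t h1 h2 h3 h4 h5 h6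
      exact ⟨h1, h2, h3, h4, h5, h6⟩) hg_le hh_le
    (fun t ht => (hδ t ht).trans (le_max_left _ _))
    (fun t ht => (hτ t ht).trans (le_max_right _ _)) hμ hμα hμν hM hvoc hYm0
    (fun s t hs hst => integral_weighted_odeFundamental_le hM hYc hYb hYfin ht₀ hμ hμν hs hst)
    hcq hF
  -- a common bound for the coefficients
  obtain ⟨K, hK, hcoef⟩ : ∃ K ≥ (0 : ℝ), ∀ᵐ t ∂(volume.restrict (Ici 0)),
      |a t| ≤ K ∧ |b t| ≤ K ∧ |a₁ t| ≤ K ∧ |b₁ t| ≤ K := by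
    have hnn : ∀ f : ℝ → ℝ, 0 ≤ (eLpNorm f ⊤ (volume.restrict (Ici 0))).toReal := fun f =>
      ENNReal.toReal_nonneg
    refine ⟨_, add_nonneg (add_nonneg (hnn a) (hnn b)) (add_nonneg (hnn a₁) (hnn b₁)), ?_⟩
    filter_upwards [ae_abs_le_toReal_eLpNorm ha.2.ne, ae_abs_le_toReal_eLpNorm hb.2.ne,
      ae_abs_le_toReal_eLpNorm ha₁.2.ne, ae_abs_le_toReal_eLpNorm hb₁.2.ne] with t h1 h2 h3 h4
    have := hnn a
    have := hnn b
    have := hnn a₁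
    have := hnn b₁
    refine ⟨?_, ?_, ?_, ?_⟩ <;> linarith
  set l := 2 * (4 * K + 1) with hl
  have hl0 : 0 < l := by positivity
  -- As `t₁ ≥ 0`, the stretch from `t₁` to `t₀` has length at most `t₀`, so this growth factor is
  -- uniform in `t₁`.
  set L := 3 * Real.exp (l * t₀) with hL
  have hL3 : 3 ≤ L := by
    have : 1 ≤ Real.exp (l * t₀) := Real.one_le_exp (by positivity)
    linarith
  -- Dominates the constants of all three cases below: `C`, `L * e^{μ t₀}` and `C * L * e^{μ t₀}`.
  -- The factor `e^{μ t₀}` pays for the decay not gained before `t₀`.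
  refine ⟨(C + 1) * L * Real.exp (μ * t₀), by positivity, μ, hμ, ?_⟩
  intro t₁ ht₁ x₀ x₀' φ ψ _ _ ⟨Cφ, hφ⟩ ⟨Cψ, hψ⟩ x y H t ht
  set S := ⨆ s : Iio t₁, (|φ s| + |ψ s|) with hS
  have hSle : ∀ s < t₁, |φ s| + |ψ s| ≤ S := fun s hs =>
    le_ciSup (f := fun s : Iio t₁ => |φ s| + |ψ s|)
      ⟨Cφ + Cψ, by rintro _ ⟨s, rfl⟩; exact add_le_add (hφ s s.2) (hψ s s.2)⟩ ⟨s, hs⟩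
  have hS0 : 0 ≤ S := le_trans (by positivity) (hSle (t₁ - 1) (by linarith))
  set N := |x₀| + |x₀'| + S with hN
  have hN0 : 0 ≤ N := by positivity
  have hx : ∀ s ≤ t₁, |x s| ≤ N := by
    intro s hs
    rcases hs.eq_or_lt with rfl | hs
    · rw [H.init]
      linarith [abs_nonneg x₀']
    · rw [H.history s hs]
      linarith [abs_nonneg x₀, abs_nonneg x₀', abs_nonneg (ψ s), hSle s hs]
  have hy : ∀ s ≤ t₁, |y s| ≤ N := by
    intro s hs
    rcases hs.eq_or_lt with rfl | hs
    · rw [H.init']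
      linarith [abs_nonneg x₀]
    · rw [H.history' s hs]
      linarith [abs_nonneg x₀, abs_nonneg x₀', abs_nonneg (φ s), hSle s hs]
  have hgrow : ∀ s ≤ t₀, |x s| ≤ L * N ∧ |y s| ≤ L * N := by
    intro s hs
    rcases le_or_gt s t₁ with h1 | h1
    · have h2 : N ≤ L * N := le_mul_of_one_le_left hN0 (by linarith)
      exact ⟨(hx s h1).trans h2, (hy s h1).trans h2⟩
    · have h2 := H.growth hK hcoef hg_le hh_le ht₁ hx hy h1.le
      have h3 : 3 * N * Real.exp (l * (s - t₁)) ≤ L * N := by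
        rw [hL, mul_right_comm]
        gcongr
        linarith
      exact ⟨h2.1.trans h3, h2.2.trans h3⟩
  have hgoal : ∀ c e : ℝ, 0 ≤ c → c ≤ C + 1 → 0 ≤ e → e ≤ L * Real.exp (μ * t₀) →
      c * e * (N * Real.exp (-μ * (t - t₁))) ≤
        (C + 1) * L * Real.exp (μ * t₀) * Real.exp (-μ * (t - t₁)) * N := by
    intro c e hc hc' he he'
    calc c * e * (N * Real.exp (-μ * (t - t₁)))
        ≤ (C + 1) * (L * Real.exp (μ * t₀)) * (N * Real.exp (-μ * (t - t₁))) := by gcongr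
      _ = _ := by ring
  have hexp1 : 1 ≤ Real.exp (μ * t₀) := Real.one_le_exp (by positivity)
  rcases le_or_gt t₀ t₁ with h1 | h1
  · have h2 := hdecay t₁ x₀ x₀' N φ ψ x y h1 H hx hy t ht
    refine h2.trans (le_trans (le_of_eq ?_) (hgoal C 1 hC (by linarith) zero_le_one
      (by nlinarith)))
    ring_nf
  · rcases le_or_gt t t₀ with h2 | h2
    · refine (hgrow t h2).1.trans (le_trans ?_ (hgoal 1 (L * Real.exp (μ * t₀)) zero_le_one
        (by linarith) (by positivity) le_rfl))
      have h3 : 1 ≤ Real.exp (μ * t₀) * Real.exp (-μ * (t - t₁)) := by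
        rw [← Real.exp_add]
        refine Real.one_le_exp ?_
        nlinarith
      calc L * N ≤ L * N * (Real.exp (μ * t₀) * Real.exp (-μ * (t - t₁))) :=
            le_mul_of_one_le_right (by positivity) h3
        _ = _ := by ring
    -- The restarted problem takes the whole past up to `t₀` as history, bounded by `L * N` through
    -- `hgrow`.
    · have h3 := hdecay t₀ _ _ (L * N) _ _ x y le_rfl (H.restart h1.le)
        (fun s hs => (hgrow s hs).1) (fun s hs => (hgrow s hs).2) t h2.le
      refine h3.trans (le_trans ?_ (hgoal C (L * Real.exp (μ * t₀)) hC
        (by linarith) (by positivity) le_rfl))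
      have h4 : Real.exp (-(μ * (t - t₀))) ≤ Real.exp (μ * t₀) * Real.exp (-μ * (t - t₁)) := by
        rw [← Real.exp_add]
        gcongr
        nlinarith
      calc C * (L * N) * Real.exp (-(μ * (t - t₀)))
          ≤ C * (L * N) * (Real.exp (μ * t₀) * Real.exp (-μ * (t - t₁))) := by gcongr
        _ = _ := by ring
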